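/- Let $\gamma:\mathbb R\to\mathbb R^2$ be a closed regular plane curve of class $C^2$, possibly with self-intersections: $\gamma$ is $C^2$, $T$-periodic for some $T>0$, and $\gamma'(t)\neq 0$ for all $t$; the curve is traversed once as $t$ runs through $[0,T)$ (the period $T$ need not be minimal). Suppose that $\gamma$ is locally convex, i.e. its signed curvature does not change sign, and that it has rotation index $n\in\mathbb Z$, i.e. a continuous choice of the angle of the tangent vector $\gamma'(t)$ changes by $2\pi n$ as $t$ goes from $0$ to $T$. A tripod configuration of $\gamma$ is an unordered triple of points of the curve (that is, of parameter values in $[0,T)$) such that the three lines normal to $\gamma$ at these points all pass through a single point and together form three angles of $2\pi/3$ (i.e. they have direction vectors making pairwise angles of $2\pi/3$). Then $\gamma$ has at least $2\left\lceil \frac{n^2+2}{3}\right\rceil$ (possibly infinitely many) tripod configurations, where $\lceil\cdot\rceil$ denotes the ceiling function. -/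

import Mathlib

namespace PlaneCurve

/-- A closed regular (immersed, possibly self-intersecting) plane curve of class `C²`, traversed
once as the parameter runs through `[0, T)`. The Euclidean plane is `ℂ`. The period `T` need not be
minimal, so a multiply covered curve is allowed. -/
structure IsClosedC2 (γ : ℝ → ℂ) (T : ℝ) : Prop where
  period_pos : 0 < T
  periodic : Function.Periodic γ T
  contDiff : ContDiff ℝ 2 γ
  regular : ∀ t, deriv γ t ≠ 0

/-- Signed curvature `det (γ', γ'') / |γ'|³` of a regular curve. -/
noncomputable def curvature (γ : ℝ → ℂ) (t : ℝ) : ℝ :=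
  ((deriv γ t).re * (deriv (deriv γ) t).im - (deriv γ t).im * (deriv (deriv γ) t).re) /
    ‖deriv γ t‖ ^ 3

/-- A regular `C²` curve is locally convex if its signed curvature does not change sign, that is,
if its tangent direction always turns in the same sense. Zeros of the curvature are allowed. -/
def LocallyConvex (γ : ℝ → ℂ) : Prop :=
  (∀ t, 0 ≤ curvature γ t) ∨ (∀ t, curvature γ t ≤ 0)

/-- The rotation index of a closed regular curve of period `T` is `n`: a continuous
determination `θ` of the angle of the tangent vector grows by `2πn` over one period. -/
def HasRotationIndex (γ : ℝ → ℂ) (T : ℝ) (n : ℤ) : Prop :=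
  ∃ θ : ℝ → ℝ, Continuous θ ∧
    (∀ t, deriv γ t = (‖deriv γ t‖ : ℂ) * Complex.exp ((θ t : ℂ) * Complex.I)) ∧
    θ T - θ 0 = 2 * Real.pi * n

/-- The normal line of `γ` at the parameter `t`: the line through `γ t` perpendicular to
`γ' t`. -/
noncomputable def normalLine (γ : ℝ → ℂ) (t : ℝ) : AffineSubspace ℝ ℂ :=
  AffineSubspace.mk' (γ t) (Submodule.span ℝ {deriv γ t})ᗮ

/-- Three lines coincide at a single point and together form three angles of `2π/3`: they have
a common point, and direction vectors making pairwise angles of `2π/3`. -/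
def FormTripod (ℓ₁ ℓ₂ ℓ₃ : AffineSubspace ℝ ℂ) : Prop :=
  (∃ P : ℂ, P ∈ ℓ₁ ∧ P ∈ ℓ₂ ∧ P ∈ ℓ₃) ∧
  ∃ u ∈ ℓ₁.direction, ∃ v ∈ ℓ₂.direction, ∃ w ∈ ℓ₃.direction,
    InnerProductGeometry.angle u v = 2 * Real.pi / 3 ∧
    InnerProductGeometry.angle v w = 2 * Real.pi / 3 ∧
    InnerProductGeometry.angle w u = 2 * Real.pi / 3

/-- The tripod configurations of a closed curve of period `T`: the unordered triples of points of
the curve (parameter values in `[0, T)`) whose normal lines coincide at a single point and together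
form three angles of `2π/3`. -/
def tripodConfigurations (γ : ℝ → ℂ) (T : ℝ) : Set (Finset ℝ) :=
  {s | ∃ a b c : ℝ, s = {a, b, c} ∧ (↑s : Set ℝ) ⊆ Set.Ico 0 T ∧
    FormTripod (normalLine γ a) (normalLine γ b) (normalLine γ c)}

end PlaneCurve

/-! Let `θ` be the tangent angle, with its sign chosen so that it is nondecreasing, `h` the
component of `γ` along the unit tangent, and `p` the support function. Then `p' = h θ'`, so `p`
descends to a function `P` of the angle, of period `2π|n|`, whose derivative is formally `h`.

The normal at `t` consists of the points whose component along the unit tangent at `t` equals `h t`.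
If three unit tangents with suitable signs sum to zero, the normals form the required angles, and
they are concurrent when the values of `h` with the same signs sum to zero
(`formTripod_of_signedBalanced`). This is the critical point equation of `P(x) - (-1)^k P(x + π/3 +
kπ) + (-1)^l P(x + 2π/3 + lπ)`. Where `γ` contains a segment, `P` has a corner, and a suitable point
of the segment replaces the derivative (`exists_sum_eq_zero_of_isMax`).

Each of the `4n²` pairs `(k, l)` gives a maximum and a minimum per period. An unordered triple
arises at most once for each choice of its base point, hence at most three times, which leaves at
least `8n²/3` configurations (`exists_finset_signedBalanced`). This suffices since `n ≠ 0`: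
otherwise the monotone angle would be periodic, hence constant. -/

open Set Filter Topology

/-! ### The support function as a function of the tangent angle -/

/-- If `p' = h θ'` with `θ' ≥ 0` and `h` is within `ε` of `m` on `[a, b]`, then the increment of `p`
is within `ε (θ b - θ a)` of `m (θ b - θ a)`. -/
theorem abs_sub_sub_mul_le_of_hasDerivAt {θ θ' h p : ℝ → ℝ} (hθ : ∀ t, HasDerivAt θ (θ' t) t)
    (hθ' : ∀ t, 0 ≤ θ' t) (hp : ∀ t, HasDerivAt p (h t * θ' t) t) {a b m ε : ℝ} (hab : a ≤ b)
    (hm : ∀ t ∈ Icc a b, |h t - m| ≤ ε) :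
    |p b - p a - m * (θ b - θ a)| ≤ ε * (θ b - θ a) := by
  have key : ∀ q q' : ℝ → ℝ, (∀ t, HasDerivAt q (q' t) t) → (∀ t ∈ Icc a b, 0 ≤ q' t) →
      q a ≤ q b := by
    intro q q' hq h0
    refine monotoneOn_of_deriv_nonneg (convex_Icc a b)
      (fun t _ => (hq t).continuousAt.continuousWithinAt)
      (fun t _ => (hq t).differentiableAt.differentiableWithinAt) ?_
      (left_mem_Icc.2 hab) (right_mem_Icc.2 hab) hab
    intro t ht
    rw [(hq t).deriv]
    exact h0 t (interior_subset ht)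
  have h1 := key (fun t => p t - (m - ε) * θ t) _ (fun t => (hp t).sub ((hθ t).const_mul _))
    (fun t ht => by nlinarith [hθ' t, (abs_le.1 (hm t ht)).1])
  have h2 := key (fun t => (m + ε) * θ t - p t) _ (fun t => ((hθ t).const_mul _).sub (hp t))
    (fun t ht => by nlinarith [hθ' t, (abs_le.1 (hm t ht)).2])
  rw [abs_le]
  constructor <;> linarith

/-- A bound for `h` on the interval bounds the increment of `p` by a multiple of the increment of
`θ`, which is zero. This makes `P` well defined. -/
theorem eq_of_angle_eq {θ θ' h p : ℝ → ℝ} (hθ : ∀ t, HasDerivAt θ (θ' t) t)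
    (hθ' : ∀ t, 0 ≤ θ' t) (hp : ∀ t, HasDerivAt p (h t * θ' t) t) (hh : Continuous h)
    {a b : ℝ} (hab : θ a = θ b) : p a = p b := by
  wlog hle : a ≤ b generalizing a b
  · exact (this hab.symm (le_of_not_ge hle)).symm
  obtain ⟨C, hC⟩ := (isCompact_Icc (a := a) (b := b)).exists_bound_of_continuousOn hh.continuousOn
  have := abs_sub_sub_mul_le_of_hasDerivAt hθ hθ' hp (m := 0) (ε := C) hle
    (fun t ht => by simpa using hC t ht)
  rw [hab, sub_self, mul_zero, mul_zero, sub_zero, abs_nonpos_iff] at this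
  linarith

/-- Angles just above `x` are attained just to the right of the last parameter `b` of angle `x`,
where `h` is close to `h b`. The left derivative uses the first such parameter instead, so `P` may
have a corner when `θ` is constant on an interval. -/
theorem hasDerivWithinAt_Ioi_of_isGreatest {θ θ' h p P : ℝ → ℝ}
    (hθ : ∀ t, HasDerivAt θ (θ' t) t) (hθ' : ∀ t, 0 ≤ θ' t)
    (hp : ∀ t, HasDerivAt p (h t * θ' t) t) (hh : Continuous h) (hP : ∀ t, P (θ t) = p t)
    {x b : ℝ} (hb : IsGreatest (θ ⁻¹' {x}) b) : HasDerivWithinAt P (h b) (Ioi x) x := by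
  have hθc : Continuous θ := continuous_iff_continuousAt.2 fun t => (hθ t).continuousAt
  have hbx : θ b = x := hb.1
  have hmono : Monotone θ := monotone_of_hasDerivAt_nonneg hθ hθ'
  rw [hasDerivWithinAt_iff_isLittleO, Asymptotics.isLittleO_iff]
  intro ε hε
  obtain ⟨δ, hδ, hδh⟩ := Metric.continuousAt_iff.1 (hh.continuousAt (x := b)) ε hε
  have hlt : x < θ (b + δ / 2) := by
    refine lt_of_le_of_ne (hbx ▸ hmono (by linarith)) fun he => ?_
    have := hb.2 (show b + δ / 2 ∈ θ ⁻¹' {x} from he.symm)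
    linarith
  filter_upwards [Ioo_mem_nhdsGT hlt] with y hy
  obtain ⟨t, ht, rfl⟩ := intermediate_value_Icc (by linarith : b ≤ b + δ / 2) hθc.continuousOn
    (show y ∈ Icc (θ b) _ from ⟨hbx.le.trans hy.1.le, hy.2.le⟩)
  have := abs_sub_sub_mul_le_of_hasDerivAt hθ hθ' hp (m := h b) (ε := ε) ht.1 (fun s hs => by
    have := hδh (x := s) (by rw [Real.dist_eq, abs_lt]; constructor <;> linarith [hs.1, hs.2, ht.2])
    exact this.le)
  rw [hbx] at this
  rw [hP, ← hbx, hP, hbx, Real.norm_eq_abs, Real.norm_eq_abs, smul_eq_mul, mul_comm (_ - x),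
    abs_of_pos (sub_pos.2 hy.1)]
  exact this

theorem hasDerivWithinAt_Iio_of_isLeast {θ θ' h p P : ℝ → ℝ}
    (hθ : ∀ t, HasDerivAt θ (θ' t) t) (hθ' : ∀ t, 0 ≤ θ' t)
    (hp : ∀ t, HasDerivAt p (h t * θ' t) t) (hh : Continuous h) (hP : ∀ t, P (θ t) = p t)
    {x a : ℝ} (ha : IsLeast (θ ⁻¹' {x}) a) : HasDerivWithinAt P (h a) (Iio x) x := by
  have h1 : HasDerivWithinAt (fun y => P (-y)) (-h a) (Ioi (-x)) (-x) := by
    -- Reversing both the parameter and the angle exchanges first and last preimages.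
    have := hasDerivWithinAt_Ioi_of_isGreatest (θ := fun t => -θ (-t)) (θ' := fun t => θ' (-t))
      (h := fun t => -h (-t)) (p := fun t => p (-t)) (P := fun y => P (-y)) (x := -x) (b := -a)
      (fun t => by
        simpa [Function.comp_def] using ((hθ (-t)).comp t (hasDerivAt_neg t)).fun_neg) (fun t => hθ' _)
      (fun t => by simpa [Function.comp_def] using ((hp (-t)).comp t (hasDerivAt_neg t))) (by fun_prop)
      (fun t => by simp [hP])
      ⟨by simpa using ha.1, fun t ht => by
        have := ha.2 (show -t ∈ θ ⁻¹' {x} by simpa using ht)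
        linarith⟩
    simpa using this
  have h2 := h1.scomp x (h := fun y => -y) (h' := -1) (s := Iio x)
    (hasDerivAt_neg x).hasDerivWithinAt (fun y hy => by simpa using hy)
  simpa [Function.comp_def] using h2

/-! ### Extrema of weighted sums of translates of `P` -/

theorem nonpos_of_hasDerivWithinAt_Ioi_of_le {F : ℝ → ℝ} {x d : ℝ}
    (hd : HasDerivWithinAt F d (Ioi x) x) (hmax : ∀ y, F y ≤ F x) : d ≤ 0 := by
  refine le_of_tendsto ((hasDerivWithinAt_iff_tendsto_slope' (by simp)).1 hd) ?_
  filter_upwards [self_mem_nhdsWithin] with y hy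
  rw [slope_def_field]
  exact div_nonpos_of_nonpos_of_nonneg (by linarith [hmax y]) (sub_pos.2 hy).le

theorem nonneg_of_hasDerivWithinAt_Iio_of_le {F : ℝ → ℝ} {x d : ℝ}
    (hd : HasDerivWithinAt F d (Iio x) x) (hmax : ∀ y, F y ≤ F x) : 0 ≤ d := by
  refine ge_of_tendsto ((hasDerivWithinAt_iff_tendsto_slope' (by simp)).1 hd) ?_
  filter_upwards [self_mem_nhdsWithin] with y hy
  rw [slope_def_field]
  exact div_nonneg_of_nonpos (by linarith [hmax y]) (sub_neg.2 hy).le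

/-- A continuous periodic function has two global extremum points within one
period. -/
theorem exists_two_extrema_of_periodic {F : ℝ → ℝ} (hF : Continuous F) {c : ℝ} (hc : 0 < c)
    (hper : Function.Periodic F c) :
    ∃ x ∈ Ico 0 c, ∃ y ∈ Ico 0 c, x ≠ y ∧ ((∀ z, F z ≤ F x) ∨ ∀ z, F x ≤ F z) ∧
      ((∀ z, F z ≤ F y) ∨ ∀ z, F y ≤ F z) := by
  have ext : ∀ G : ℝ → ℝ, Continuous G → Function.Periodic G c →
      ∃ x ∈ Ico 0 c, ∀ z, G z ≤ G x := by
    intro G hG hGp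
    obtain ⟨x, -, hx⟩ := isCompact_Icc.exists_isMaxOn (nonempty_Icc.2 hc.le) hG.continuousOn
    obtain ⟨w, hw, hxw⟩ : ∃ w ∈ Ico 0 c, G x = G w := by simpa using hGp.exists_mem_Ico hc x 0
    refine ⟨w, hw, fun z => ?_⟩
    obtain ⟨v, hv, hzv⟩ : ∃ w ∈ Ico 0 c, G z = G w := by simpa using hGp.exists_mem_Ico hc z 0
    rw [hzv, ← hxw]
    exact hx (Ico_subset_Icc_self hv)
  obtain ⟨x, hx, hxm⟩ := ext F hF hper
  obtain ⟨y, hy, hym⟩ := ext (fun z => -F z) hF.neg (fun z => by simp [hper z])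
  -- If a maximum point is also a minimum point, the function is constant and any two points serve.
  by_cases hxy : x = y
  · subst hxy
    have hconst : ∀ z, F z = F x := fun z => le_antisymm (hxm z) (neg_le_neg_iff.1 (hym z))
    exact ⟨0, ⟨le_rfl, hc⟩, c / 2, ⟨by positivity, by linarith⟩, by positivity,
      Or.inl fun z => by rw [hconst z, hconst 0], Or.inl fun z => by rw [hconst z, hconst (c / 2)]⟩
  · exact ⟨x, hx, y, hy, hxy, Or.inl hxm, Or.inr fun z => neg_le_neg_iff.1 (hym z)⟩

section Tripod

variable {θ θ' h p : ℝ → ℝ} {T L : ℝ}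

theorem surjective_of_add_period (hθc : Continuous θ)
    (hL : 0 < L) (hθT : ∀ t, θ (t + T) = θ t + L) : Function.Surjective θ := by
  have hnat : ∀ (n : ℕ) t, θ (t + n * T) = θ t + n * L := by
    intro n
    induction n with
    | zero => simp
    | succ k ih =>
      intro t
      have : t + (k + 1 : ℕ) * T = (t + k * T) + T := by push_cast; ring
      rw [this, hθT, ih]; push_cast; ring
  intro x
  obtain ⟨n, hn⟩ := exists_nat_gt ((|x| + |θ 0|) / L)
  rw [div_lt_iff₀ hL] at hn
  have h1 := hnat n 0
  have h2 := hnat n (0 - n * T)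
  rw [sub_add_cancel] at h2
  refine mem_range_of_exists_le_of_exists_ge hθc ⟨0 - n * T, ?_⟩ ⟨0 + n * T, ?_⟩ <;>
    linarith [le_abs_self x, neg_abs_le x, le_abs_self (θ 0), neg_abs_le (θ 0)]

theorem exists_isLeast_isGreatest_preimage (hθc : Continuous θ) (hmono : Monotone θ)
    (hsurj : Function.Surjective θ) (x : ℝ) :
    ∃ a b, IsLeast (θ ⁻¹' {x}) a ∧ IsGreatest (θ ⁻¹' {x}) b := by
  obtain ⟨s, hs⟩ := hsurj (x - 1)
  obtain ⟨t, ht⟩ := hsurj (x + 1)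
  have hK : IsCompact (θ ⁻¹' {x}) := by
    refine isCompact_Icc.of_isClosed_subset (isClosed_singleton.preimage hθc) (s := Icc s t) ?_
    intro y hy
    have hy : θ y = x := hy
    constructor <;> by_contra! hlt <;> have := hmono hlt.le <;> linarith
  have hne : (θ ⁻¹' {x}).Nonempty := hsurj x
  exact ⟨_, _, (hK.exists_isLeast hne).choose_spec, (hK.exists_isGreatest hne).choose_spec⟩

/-- At a global maximum of `∑ eᵢ P (x + cᵢ)` the weighted sum of the values of `h` vanishes for
suitable parameters of tangent angles `x + cᵢ`. -/
theorem exists_sum_eq_zero_of_isMax (hθ : ∀ t, HasDerivAt θ (θ' t) t)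
    (hθ' : ∀ t, 0 ≤ θ' t) (hp : ∀ t, HasDerivAt p (h t * θ' t) t) (hh : Continuous h)
    (hsurj : Function.Surjective θ) {P : ℝ → ℝ} (hP : ∀ t, P (θ t) = p t)
    {ι : Type*} [Fintype ι] (e c : ι → ℝ) {x : ℝ}
    (hmax : ∀ y, ∑ i, e i * P (y + c i) ≤ ∑ i, e i * P (x + c i)) :
    ∃ t : ι → ℝ, (∀ i, θ (t i) = x + c i) ∧ ∑ i, e i * h (t i) = 0 := by
  have hθc : Continuous θ := continuous_iff_continuousAt.2 fun t => (hθ t).continuousAt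
  have hmono : Monotone θ := monotone_of_hasDerivAt_nonneg hθ hθ'
  choose a b ha hb using fun i => exists_isLeast_isGreatest_preimage hθc hmono hsurj (x + c i)
  have hright : ∑ i, e i * h (b i) ≤ 0 := by
    refine nonpos_of_hasDerivWithinAt_Ioi_of_le (F := fun y => ∑ i, e i * P (y + c i)) (x := x)
      (HasDerivWithinAt.fun_sum fun i _ => HasDerivWithinAt.const_mul _ ?_) hmax
    have := hasDerivWithinAt_Ioi_of_isGreatest hθ hθ' hp hh hP (hb i)
    simpa [Function.comp_def] using this.scomp x (h := fun y => y + c i) (s := Ioi x)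
      ((hasDerivAt_id x).add_const _).hasDerivWithinAt (fun y hy => by simpa using hy)
  have hleft : 0 ≤ ∑ i, e i * h (a i) := by
    refine nonneg_of_hasDerivWithinAt_Iio_of_le (F := fun y => ∑ i, e i * P (y + c i)) (x := x)
      (HasDerivWithinAt.fun_sum fun i _ => HasDerivWithinAt.const_mul _ ?_) hmax
    have := hasDerivWithinAt_Iio_of_isLeast hθ hθ' hp hh hP (ha i)
    simpa [Function.comp_def] using this.scomp x (h := fun y => y + c i) (s := Iio x)
      ((hasDerivAt_id x).add_const _).hasDerivWithinAt (fun y hy => by simpa using hy)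
  -- The sum is nonnegative at the first preimages `a i` and nonpositive at the last ones `b i`.
  -- Moving all parameters linearly from `a i` to `b i` keeps every angle fixed, so the sum vanishes
  -- somewhere on the way.
  have hcont : Continuous fun s : ℝ => ∑ i, e i * h (a i + s * (b i - a i)) := by fun_prop
  obtain ⟨s, hs, hs0⟩ := intermediate_value_Icc' zero_le_one hcont.continuousOn
    (show (0 : ℝ) ∈ Icc _ _ from ⟨by simpa using hright, by simpa using hleft⟩)
  refine ⟨fun i => a i + s * (b i - a i), fun i => ?_, hs0⟩
  have hab : a i ≤ b i := (ha i).2 (hb i).1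
  have h1 : θ (a i) = x + c i := (ha i).1
  have h2 : θ (b i) = x + c i := (hb i).1
  refine le_antisymm (h2 ▸ hmono ?_) (h1 ▸ hmono ?_) <;> nlinarith [hs.1, hs.2]

/-- For all weights and shifts, `∑ eᵢ h (tᵢ)` vanishes along at least two classes of parameters of
tangent angles `x + cᵢ`, with distinct `x` in one period. -/
theorem exists_two_sum_eq_zero (hθ : ∀ t, HasDerivAt θ (θ' t) t)
    (hθ' : ∀ t, 0 ≤ θ' t) (hp : ∀ t, HasDerivAt p (h t * θ' t) t) (hh : Continuous h)
    (hL : 0 < L) (hθT : ∀ t, θ (t + T) = θ t + L) (hpT : Function.Periodic p T)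
    {ι : Type*} [Fintype ι] (e c : ι → ℝ) :
    ∃ x : Fin 2 → ℝ, Function.Injective x ∧ (∀ j, x j ∈ Ico 0 L) ∧
      ∀ j, ∃ t : ι → ℝ, (∀ i, θ (t i) = x j + c i) ∧ ∑ i, e i * h (t i) = 0 := by
  have hθc : Continuous θ := continuous_iff_continuousAt.2 fun t => (hθ t).continuousAt
  have hmono : Monotone θ := monotone_of_hasDerivAt_nonneg hθ hθ'
  have hsurj := surjective_of_add_period hθc hL hθT
  obtain ⟨P, hP⟩ : ∃ P : ℝ → ℝ, ∀ t, P (θ t) = p t :=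
    ⟨fun x => p (Function.surjInv hsurj x), fun t =>
      eq_of_angle_eq hθ hθ' hp hh (Function.surjInv_eq hsurj _)⟩
  -- One-sided differentiability on both sides already gives continuity.
  have hPc : Continuous P := by
    refine continuous_iff_continuousAt.2 fun x => continuousAt_iff_continuous_left'_right'.2 ?_
    obtain ⟨a, b, ha, hb⟩ := exists_isLeast_isGreatest_preimage hθc hmono hsurj x
    exact ⟨(hasDerivWithinAt_Iio_of_isLeast hθ hθ' hp hh hP ha).continuousWithinAt,
      (hasDerivWithinAt_Ioi_of_isGreatest hθ hθ' hp hh hP hb).continuousWithinAt⟩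
  have hPL : Function.Periodic P L := by
    intro x
    obtain ⟨t, rfl⟩ := hsurj x
    rw [← hθT, hP, hP, hpT]
  obtain ⟨x, hx, y, hy, hxy, hxe, hye⟩ := exists_two_extrema_of_periodic
    (F := fun y => ∑ i, e i * P (y + c i)) (by fun_prop) hL (fun y => by
      refine Finset.sum_congr rfl fun i _ => ?_
      rw [add_right_comm, hPL])
  have main : ∀ x, ((∀ z, ∑ i, e i * P (z + c i) ≤ ∑ i, e i * P (x + c i)) ∨
      ∀ z, ∑ i, e i * P (x + c i) ≤ ∑ i, e i * P (z + c i)) →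
      ∃ t : ι → ℝ, (∀ i, θ (t i) = x + c i) ∧ ∑ i, e i * h (t i) = 0 := by
    rintro x (hx | hx)
    · exact exists_sum_eq_zero_of_isMax hθ hθ' hp hh hsurj hP e c hx
    · obtain ⟨t, ht, h0⟩ := exists_sum_eq_zero_of_isMax hθ hθ' hp hh hsurj hP (fun i => -e i) c
        (x := x) (by simpa using hx)
      exact ⟨t, ht, by simpa using h0⟩
  refine ⟨![x, y], ?_, ?_, ?_⟩
  · intro i j
    fin_cases i <;> fin_cases j <;> simp [hxy, hxy.symm]
  · intro j; fin_cases j <;> assumption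
  · intro j; fin_cases j
    · exact main x hxe
    · exact main y hye

end Tripod

/-! ### Counting signed balanced triples -/

theorem eq_of_cast_mul_pi_eq {a b : ℤ} (h : (a : ℝ) * Real.pi = b * Real.pi) : a = b := by
  exact_mod_cast mul_right_cancel₀ Real.pi_ne_zero h

theorem cos_sub_cos_add_cos_eq_zero (x : ℝ) :
    Real.cos x - Real.cos (x + Real.pi / 3) + Real.cos (x + 2 * Real.pi / 3) = 0 := by
  have h3 : √(3 : ℝ) * √3 = 3 := Real.mul_self_sqrt (by norm_num)
  rw [show x + 2 * Real.pi / 3 = x + Real.pi / 3 + Real.pi / 3 by ring, Real.cos_add (_ + _),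
    Real.cos_add, Real.sin_add, Real.cos_pi_div_three, Real.sin_pi_div_three]
  linear_combination (-Real.cos x / 4) * h3

theorem sin_sub_sin_add_sin_eq_zero (x : ℝ) :
    Real.sin x - Real.sin (x + Real.pi / 3) + Real.sin (x + 2 * Real.pi / 3) = 0 := by
  have := cos_sub_cos_add_cos_eq_zero (x - Real.pi / 2)
  rwa [sub_add_eq_add_sub x, sub_add_eq_add_sub x, Real.cos_sub_pi_div_two, Real.cos_sub_pi_div_two,
    Real.cos_sub_pi_div_two] at this

/-- Three parameters at which the unit vectors `(cos θ, sin θ)`, suitably signed, sum to zero, while so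
do the values of `h` with the same signs. -/
def SignedBalanced (θ h : ℝ → ℝ) (a b c : ℝ) : Prop :=
  ∃ e₁ e₂ : ℝ, e₁ ^ 2 = 1 ∧ e₂ ^ 2 = 1 ∧
    Real.cos (θ a) + e₁ * Real.cos (θ b) + e₂ * Real.cos (θ c) = 0 ∧
    Real.sin (θ a) + e₁ * Real.sin (θ b) + e₂ * Real.sin (θ c) = 0 ∧
    h a + e₁ * h b + e₂ * h c = 0

theorem exists_finset_signedBalanced {θ θ' h p : ℝ → ℝ} {T : ℝ} {n : ℕ}
    (hθ : ∀ t, HasDerivAt θ (θ' t) t) (hθ' : ∀ t, 0 ≤ θ' t)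
    (hp : ∀ t, HasDerivAt p (h t * θ' t) t) (hh : Continuous h) (hT : 0 < T) (hn : 0 < n)
    (hθT : ∀ t, θ (t + T) = θ t + 2 * Real.pi * n) (hpT : Function.Periodic p T)
    (hhT : Function.Periodic h T) :
    ∃ F : Finset (Finset ℝ), 8 * n ^ 2 ≤ 3 * F.card ∧
      ∀ s ∈ F, ∃ a b c, s = {a, b, c} ∧ (s : Set ℝ) ⊆ Ico 0 T ∧ SignedBalanced θ h a b c := by
  classical
  have hpi := Real.pi_pos
  have hn' : (0 : ℝ) < n := by exact_mod_cast hn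
  have hθz : ∀ (m : ℤ) t, θ (t - m • T) = θ t - 2 * Real.pi * n * m := by
    -- Removing the linear drift makes `θ` periodic, which handles all integer shifts at once.
    have hper : Function.Periodic (fun t => θ t - 2 * Real.pi * n / T * t) T := fun t => by
      simp only [hθT]; field_simp; ring
    intro m t
    have := hper.sub_zsmul_eq m (x := t)
    simp only [zsmul_eq_mul] at this ⊢
    have hT' : 2 * Real.pi * n / T * (m * T) = 2 * Real.pi * n * m := by field_simp
    linear_combination this - hT'
  -- The unit vectors at `x`, `x + π/3`, `x + 2π/3` with signs `+, -, +` sum to zero. Adding `kπ` or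
  -- `lπ` to an angle reverses its vector, so its sign changes by `(-1)^k` or `(-1)^l`. Angles
  -- matter modulo `2πn`, so `k` and `l` range over `2n` values.
  let e : Fin (2 * n) → Fin (2 * n) → Fin 3 → ℝ := fun k l =>
    ![1, -(-1) ^ (k : ℕ), (-1) ^ (l : ℕ)]
  let c : Fin (2 * n) → Fin (2 * n) → Fin 3 → ℝ := fun k l =>
    ![0, Real.pi / 3 + (k : ℕ) * Real.pi, 2 * Real.pi / 3 + (l : ℕ) * Real.pi]
  choose x hxinj hxmem t htθ hth using fun k l =>
    exists_two_sum_eq_zero hθ hθ' hp hh (by positivity : 0 < 2 * Real.pi * n) hθT hpT (e k l) (c k l)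
  obtain ⟨r, hr⟩ : ∃ r : Fin (2 * n) → Fin (2 * n) → Fin 2 → Fin 3 → ℝ,
      ∀ k l j i, r k l j i = toIcoMod hT 0 (t k l j i) := ⟨_, fun _ _ _ _ => rfl⟩
  have hrmem : ∀ k l j i, r k l j i ∈ Ico 0 T := fun k l j i => by
    rw [hr]; simpa using toIcoMod_mem_Ico hT 0 (t k l j i)
  have hrθ : ∀ k l j i, ∃ m : ℤ, θ (r k l j i) = x k l j + c k l i - 2 * Real.pi * n * m :=
    fun k l j i => ⟨toIcoDiv hT 0 (t k l j i), by rw [hr, toIcoMod, hθz, htθ]⟩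
  choose m hm using hrθ
  have hrh : ∀ k l j, ∑ i, e k l i * h (r k l j i) = 0 := fun k l j => by
    rw [← hth k l j]
    refine Finset.sum_congr rfl fun i _ => ?_
    rw [hr, toIcoMod, hhT.sub_zsmul_eq]
  simp only [Fin.sum_univ_three, e] at hrh
  have hm0 : ∀ k l j, θ (r k l j 0) = x k l j - 2 * Real.pi * n * m k l j 0 := fun k l j => by
    simpa [c] using hm k l j 0
  have hm1 : ∀ k l j, θ (r k l j 1) =
      x k l j + Real.pi / 3 + (k : ℕ) * Real.pi - 2 * Real.pi * n * m k l j 1 :=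
    fun k l j => by simpa [c, add_assoc] using hm k l j 1
  have hm2 : ∀ k l j, θ (r k l j 2) =
      x k l j + 2 * Real.pi / 3 + (l : ℕ) * Real.pi - 2 * Real.pi * n * m k l j 2 :=
    fun k l j => by simpa [c, add_assoc] using hm k l j 2
  let f : Fin (2 * n) × Fin (2 * n) × Fin 2 → Finset ℝ := fun q =>
    {r q.1 q.2.1 q.2.2 0, r q.1 q.2.1 q.2.2 1, r q.1 q.2.1 q.2.2 2}
  have hmodEq : ∀ {u v : Fin (2 * n)} {z : ℤ}, ((u : ℕ) : ℤ) - (v : ℕ) = 2 * n * z → u = v := by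
    intro u v z huv
    have hz : z = 0 := by
      by_contra hz
      have hu := u.2
      have hv := v.2
      have : (2 * n : ℤ) ≤ |2 * n * z| := by
        rw [abs_mul, abs_of_nonneg (by positivity : (0 : ℤ) ≤ 2 * n)]
        have := Int.one_le_abs hz
        nlinarith
      rw [← huv] at this
      have h2 : |((u : ℕ) : ℤ) - (v : ℕ)| < 2 * n := by rw [abs_lt]; constructor <;> omega
      omega
    subst hz
    ext; omega
  -- Modulo `π` the three angles are `x`, `x + π/3`, `x + 2π/3`, so once the base point is fixed the
  -- roles of the other two are forced. Their angles relative to the base, modulo `2πn`, then give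
  -- `k` and `l`. Mismatched roles contradict divisibility by 3.
  have hinj : ∀ q q', f q = f q' → r q.1 q.2.1 q.2.2 0 = r q'.1 q'.2.1 q'.2.2 0 → q = q' := by
    rintro ⟨k, l, j⟩ ⟨k', l', j'⟩ hf h0
    simp only [f] at hf h0
    have e0 := congrArg θ h0
    rw [hm0, hm0] at e0
    have hk : k = k' := by
      have hmem : r k l j 1 ∈ ({r k' l' j' 0, r k' l' j' 1, r k' l' j' 2} : Finset ℝ) := by
        rw [← hf]; simp
      simp only [Finset.mem_insert, Finset.mem_singleton] at hmem
      rcases hmem with h1 | h1 | h1 <;> have e1 := congrArg θ h1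
      · rw [hm1, hm0] at e1
        have := @eq_of_cast_mul_pi_eq (1 + 3 * (k - 2 * n * (m k l j 1 - m k l j 0))) 0 (by
          push_cast; linear_combination 3 * e1 - 3 * e0)
        omega
      · rw [hm1, hm1] at e1
        refine hmodEq (z := m k l j 1 - m k l j 0 - m k' l' j' 1 + m k' l' j' 0) ?_
        refine eq_of_cast_mul_pi_eq ?_
        push_cast; linear_combination e1 - e0
      · rw [hm1, hm2] at e1
        have := @eq_of_cast_mul_pi_eq
          (3 * (k - l' - 2 * n * (m k l j 1 - m k l j 0 - m k' l' j' 2 + m k' l' j' 0))) 1 (by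
          push_cast; linear_combination 3 * e1 - 3 * e0)
        omega
    have hl : l = l' := by
      have hmem : r k l j 2 ∈ ({r k' l' j' 0, r k' l' j' 1, r k' l' j' 2} : Finset ℝ) := by
        rw [← hf]; simp
      simp only [Finset.mem_insert, Finset.mem_singleton] at hmem
      rcases hmem with h1 | h1 | h1 <;> have e1 := congrArg θ h1
      · rw [hm2, hm0] at e1
        have := @eq_of_cast_mul_pi_eq (2 + 3 * (l - 2 * n * (m k l j 2 - m k l j 0))) 0 (by
          push_cast; linear_combination 3 * e1 - 3 * e0)
        omega
      · rw [hm2, hm1] at e1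
        have := @eq_of_cast_mul_pi_eq
          (3 * (l - k' - 2 * n * (m k l j 2 - m k l j 0 - m k' l' j' 1 + m k' l' j' 0))) (-1) (by
          push_cast; linear_combination 3 * e1 - 3 * e0)
        omega
      · rw [hm2, hm2] at e1
        refine hmodEq (z := m k l j 2 - m k l j 0 - m k' l' j' 2 + m k' l' j' 0) ?_
        refine eq_of_cast_mul_pi_eq ?_
        push_cast; linear_combination e1 - e0
    subst hk hl
    -- The two values agree modulo `2πn` and lie in the same half-open period.
    have hxeq : x k l j = x k l j' := by
      obtain ⟨h1, h2⟩ := hxmem k l j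
      obtain ⟨h3, h4⟩ := hxmem k l j'
      have hper : x k l j - x k l j' = 2 * Real.pi * n * ((m k l j 0 - m k l j' 0 : ℤ) : ℝ) := by
        push_cast; linarith
      have hz : m k l j 0 - m k l j' 0 = 0 := by
        by_contra hz
        have h5 : (1 : ℝ) ≤ |((m k l j 0 - m k l j' 0 : ℤ) : ℝ)| := by
          exact_mod_cast Int.one_le_abs hz
        have hL : 0 < 2 * Real.pi * n := by positivity
        have h6 : |x k l j - x k l j'| < 2 * Real.pi * n := by
          rw [abs_lt]; constructor <;> linarith
        rw [hper, abs_mul, abs_of_pos hL] at h6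
        nlinarith
      rw [hz] at hper
      simpa [sub_eq_zero] using hper
    rw [hxinj k l hxeq]
  refine ⟨Finset.univ.image f, ?_, ?_⟩
  -- On a fibre of `f` the base point determines the index and belongs to the triple, so the fibre
  -- has at most three elements.
  · have hcard := Finset.card_le_mul_card_image (f := f) Finset.univ 3 (by
      intro s hs
      obtain ⟨q₀, -, rfl⟩ := Finset.mem_image.1 hs
      refine (Finset.card_le_card_of_injOn (t := f q₀) (fun q => r q.1 q.2.1 q.2.2 0) ?_ ?_).trans
        Finset.card_le_three
      · intro q hq
        have hq : f q = f q₀ := by simpa using hq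
        rw [← hq]
        simp [f]
      · intro q hq q' hq' h0
        have hq : f q = f q₀ := by simpa using hq
        have hq' : f q' = f q₀ := by simpa using hq'
        exact hinj q q' (hq.trans hq'.symm) h0)
    simp only [Finset.card_univ, Fintype.card_prod, Fintype.card_fin] at hcard
    calc 8 * n ^ 2 = 2 * n * (2 * n * 2) := by ring
      _ ≤ _ := hcard
  · intro s hs
    obtain ⟨⟨k, l, j⟩, -, rfl⟩ := Finset.mem_image.1 hs
    have hsq : ∀ k : ℕ, ((-1 : ℝ) ^ k) ^ 2 = 1 := fun k => by rw [pow_right_comm]; simp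
    refine ⟨_, _, _, rfl, ?_, -(-1) ^ (k : ℕ), (-1) ^ (l : ℕ), ?_, ?_, ?_, ?_, ?_⟩
    · intro y hy
      simp only [f, Finset.coe_insert, Finset.coe_singleton, mem_insert_iff, mem_singleton_iff] at hy
      rcases hy with rfl | rfl | rfl <;> exact hrmem _ _ _ _
    · rw [neg_sq, hsq]
    · exact hsq l
    · have hcos : ∀ (y : ℝ) (z : ℤ), Real.cos (y - 2 * Real.pi * n * z) = Real.cos y := fun y z => by
        have := Real.cos_sub_int_mul_two_pi y (n * z)
        rw [← this]; push_cast; ring_nf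
      rw [hm0, hm1, hm2, hcos, hcos, hcos, Real.cos_add_nat_mul_pi, Real.cos_add_nat_mul_pi]
      linear_combination cos_sub_cos_add_cos_eq_zero (x k l j) -
        Real.cos (x k l j + Real.pi / 3) * hsq k + Real.cos (x k l j + 2 * Real.pi / 3) * hsq l
    · have hsin : ∀ (y : ℝ) (z : ℤ), Real.sin (y - 2 * Real.pi * n * z) = Real.sin y := fun y z => by
        have := Real.sin_sub_int_mul_two_pi y (n * z)
        rw [← this]; push_cast; ring_nf
      rw [hm0, hm1, hm2, hsin, hsin, hsin, Real.sin_add_nat_mul_pi, Real.sin_add_nat_mul_pi]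
      linear_combination sin_sub_sin_add_sin_eq_zero (x k l j) -
        Real.sin (x k l j + Real.pi / 3) * hsq k + Real.sin (x k l j + 2 * Real.pi / 3) * hsq l
    · simpa using hrh k l j
-- Tangent angle and normal lines of the curve
namespace PlaneCurve

variable {γ : ℝ → ℂ} {T : ℝ} {θ : ℝ → ℝ}

/-- Rotated by `-θ t`, the tangent stays near the positive real axis for parameters near `t`, so
there `θ` equals `θ t` plus the imaginary part of the principal logarithm of the rotated tangent. -/
theorem hasDerivAt_angle (hγ : IsClosedC2 γ T) (hθc : Continuous θ)
    (hθ : ∀ t, deriv γ t = (‖deriv γ t‖ : ℂ) * Complex.exp ((θ t : ℂ) * Complex.I)) (t : ℝ) :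
    HasDerivAt θ (curvature γ t * ‖deriv γ t‖) t := by
  have hpos : 0 < ‖deriv γ t‖ := norm_pos_iff.2 (hγ.regular t)
  have hd : HasDerivAt (deriv γ) (deriv (deriv γ) t) t :=
    ((contDiff_succ_iff_deriv (n := 1).1 hγ.contDiff).2.2.differentiable (by simp) t).hasDerivAt
  set w : ℂ := Complex.exp (-((θ t : ℂ) * Complex.I)) with hw
  have hrot : ∀ s, deriv γ s * w = (‖deriv γ s‖ : ℂ) * Complex.exp (((θ s - θ t : ℝ) : ℂ) * Complex.I) := by
    intro s
    rw [hθ s, hw, mul_assoc, ← Complex.exp_add]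
    simp only [norm_mul, Complex.norm_real, norm_norm, Complex.norm_exp_ofReal_mul_I, mul_one]
    push_cast
    ring_nf
  have hval : deriv γ t * w = (‖deriv γ t‖ : ℂ) := by rw [hrot t]; simp
  have hlog := (hd.mul_const w).clog_real (by rw [hval]; exact Complex.ofReal_mem_slitPlane.2 hpos)
  have him := (Complex.imCLM.hasFDerivAt.comp_hasDerivAt t hlog).const_add (θ t)
  have hw' : w = (starRingEnd ℂ) (deriv γ t) / ‖deriv γ t‖ := by
    have h1 : (‖deriv γ t‖ : ℂ) ≠ 0 := by exact_mod_cast hpos.ne'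
    have h2 := congrArg (starRingEnd ℂ) (hθ t)
    rw [map_mul, Complex.conj_ofReal, ← Complex.exp_conj, map_mul, Complex.conj_ofReal,
      Complex.conj_I, mul_neg] at h2
    rw [eq_div_iff h1, h2, mul_comm]
  have hder : (Complex.imCLM (deriv (deriv γ) t * w / (deriv γ t * w))) =
      curvature γ t * ‖deriv γ t‖ := by
    rw [hval, hw', curvature, mul_div_assoc', div_div, ← Complex.ofReal_mul, Complex.imCLM_apply,
      Complex.div_ofReal_im, Complex.mul_im, Complex.conj_re, Complex.conj_im]
    field_simp
    ring
  rw [hder] at him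
  refine him.congr_of_eventuallyEq ?_
  have hnear : ∀ᶠ s in 𝓝 t, |θ s - θ t| < Real.pi := by
    simpa [Real.dist_eq] using Metric.tendsto_nhds.1 (hθc.tendsto t) Real.pi Real.pi_pos
  filter_upwards [hnear] with s hs
  rw [abs_lt] at hs
  simp only [Function.comp_apply, Complex.imCLM_apply, Complex.log_im, hrot s]
  rw [Complex.arg_real_mul _ (norm_pos_iff.2 (hγ.regular s)), Complex.arg_exp_mul_I,
    toIocMod_eq_self _ |>.2 ⟨hs.1, by linarith [hs.2]⟩]
  ring

/-- The increment over a period, divided by `2π`, is continuous and integer valued, hence constant.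
-/
theorem angle_add_period (hγ : IsClosedC2 γ T) (hθc : Continuous θ)
    (hθ : ∀ t, deriv γ t = (‖deriv γ t‖ : ℂ) * Complex.exp ((θ t : ℂ) * Complex.I)) (t : ℝ) :
    θ (t + T) = θ t + (θ T - θ 0) := by
  have hint : ∀ t, ∃ m : ℤ, (θ (t + T) - θ t) / (2 * Real.pi) = m := by
    intro t
    have hper : deriv γ (t + T) = deriv γ t := by
      rw [← deriv_comp_add_const]
      congr 1
      exact funext hγ.periodic
    have h1 := hθ (t + T)
    rw [hper, hθ t] at h1
    simp only [norm_mul, Complex.norm_real, norm_norm, Complex.norm_exp_ofReal_mul_I, mul_one] at h1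
    have h2 := mul_left_cancel₀ (by simpa using hγ.regular t) h1
    obtain ⟨m, hm⟩ := Complex.exp_eq_exp_iff_exists_int.1 h2.symm
    refine ⟨m, ?_⟩
    have h3 : ((θ (t + T) : ℝ) : ℂ) = ((θ t + m * (2 * Real.pi) : ℝ) : ℂ) := by
      apply mul_right_cancel₀ Complex.I_ne_zero
      rw [hm]; push_cast; ring
    rw [Complex.ofReal_inj.1 h3]
    field_simp
    ring
  have hconst : (θ (t + T) - θ t) / (2 * Real.pi) = (θ (0 + T) - θ 0) / (2 * Real.pi) := by
    choose m hm using hint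
    have hc : Continuous m := by
      rw [Int.isClosedEmbedding_coe_real.isEmbedding.continuous_iff]
      have : ((↑) : ℤ → ℝ) ∘ m = fun t => (θ (t + T) - θ t) / (2 * Real.pi) :=
        funext fun t => (hm t).symm
      rw [this]
      fun_prop
    rw [hm, hm, PreconnectedSpace.constant inferInstance hc (x := t) (y := 0)]
  have hpi : 2 * Real.pi ≠ 0 := by positivity
  rw [div_left_inj' hpi, zero_add] at hconst
  linarith

theorem mem_normalLine_iff
    (hγ : IsClosedC2 γ T)
    (hθ : ∀ t, deriv γ t = (‖deriv γ t‖ : ℂ) * Complex.exp ((θ t : ℂ) * Complex.I)) (t : ℝ)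
    (P : ℂ) : P ∈ normalLine γ t ↔ P.re * Real.cos (θ t) + P.im * Real.sin (θ t) =
      (γ t).re * Real.cos (θ t) + (γ t).im * Real.sin (θ t) := by
  have hpos : ‖deriv γ t‖ ≠ 0 := norm_ne_zero_iff.2 (hγ.regular t)
  have hre : (deriv γ t).re = ‖deriv γ t‖ * Real.cos (θ t) := by
    conv_lhs => rw [hθ t, Complex.re_ofReal_mul, Complex.exp_ofReal_mul_I_re]
  have him : (deriv γ t).im = ‖deriv γ t‖ * Real.sin (θ t) := by
    conv_lhs => rw [hθ t, Complex.im_ofReal_mul, Complex.exp_ofReal_mul_I_im]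
  rw [normalLine, AffineSubspace.mem_mk', Submodule.mem_orthogonal_singleton_iff_inner_right,
    Complex.inner, vsub_eq_sub]
  simp only [Complex.mul_re, Complex.conj_re, Complex.conj_im, Complex.sub_re, Complex.sub_im]
  rw [hre, him]
  constructor
  · intro h
    refine mul_left_cancel₀ hpos ?_
    linear_combination h
  · intro h
    linear_combination ‖deriv γ t‖ * h

theorem mem_normalLine_direction
    (hθ : ∀ t, deriv γ t = (‖deriv γ t‖ : ℂ) * Complex.exp ((θ t : ℂ) * Complex.I)) (t e : ℝ) :
    (⟨-(e * Real.sin (θ t)), e * Real.cos (θ t)⟩ : ℂ) ∈ (normalLine γ t).direction := by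
  rw [normalLine, AffineSubspace.direction_mk', Submodule.mem_orthogonal_singleton_iff_inner_right,
    Complex.inner, hθ t]
  simp only [Complex.mul_re, Complex.conj_re, Complex.conj_im, Complex.ofReal_re, Complex.ofReal_im,
    Complex.im_ofReal_mul, Complex.exp_ofReal_mul_I_re, Complex.exp_ofReal_mul_I_im]
  ring

theorem angle_eq_two_pi_div_three {u v : ℂ} (hu : u.re ^ 2 + u.im ^ 2 = 1)
    (hv : v.re ^ 2 + v.im ^ 2 = 1) (huv : u.re * v.re + u.im * v.im = -1 / 2) :
    InnerProductGeometry.angle u v = 2 * Real.pi / 3 := by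
  have hnorm : ∀ z : ℂ, z.re ^ 2 + z.im ^ 2 = 1 → ‖z‖ = 1 := fun z hz => by
    rw [Complex.norm_def, Complex.normSq_apply, ← sq, ← sq, hz, Real.sqrt_one]
  have hcos : Real.cos (2 * Real.pi / 3) = -1 / 2 := by
    rw [show 2 * Real.pi / 3 = Real.pi - Real.pi / 3 by ring, Real.cos_pi_sub,
      Real.cos_pi_div_three]
    norm_num
  rw [InnerProductGeometry.angle, hnorm u hu, hnorm v hv, Complex.inner]
  simp only [Complex.mul_re, Complex.conj_re, Complex.conj_im, mul_one, div_one]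
  rw [show v.re * u.re - v.im * -u.im = -1 / 2 by linarith, ← hcos,
    Real.arccos_cos (by positivity) (by linarith [Real.pi_pos])]

theorem inner_eq_neg_half_of_add_eq_zero {x y z x' y' z' : ℝ} (hx : x ^ 2 + x' ^ 2 = 1)
    (hy : y ^ 2 + y' ^ 2 = 1) (hz : z ^ 2 + z' ^ 2 = 1) (h : x + y + z = 0)
    (h' : x' + y' + z' = 0) : x * y + x' * y' = -1 / 2 := by
  obtain rfl : z = -x - y := by linarith
  obtain rfl : z' = -x' - y' := by linarith
  linear_combination (hz - hx - hy) / 2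

theorem formTripod_of_signedBalanced (hγ : IsClosedC2 γ T)
    (hθ : ∀ t, deriv γ t = (‖deriv γ t‖ : ℂ) * Complex.exp ((θ t : ℂ) * Complex.I)) {a b c : ℝ}
    (habc : SignedBalanced θ
      (fun t => (γ t).re * Real.cos (θ t) + (γ t).im * Real.sin (θ t)) a b c) :
    FormTripod (normalLine γ a) (normalLine γ b) (normalLine γ c) := by
  obtain ⟨e₁, e₂, he₁, he₂, hcos, hsin, hh⟩ := habc
  have ha := Real.cos_sq_add_sin_sq (θ a)
  have hb := Real.cos_sq_add_sin_sq (θ b)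
  have hc := Real.cos_sq_add_sin_sq (θ c)
  have hmem := mem_normalLine_iff hγ hθ
  have hda := mem_normalLine_direction hθ a 1
  have hdb := mem_normalLine_direction hθ b e₁
  have hdc := mem_normalLine_direction hθ c e₂
  beta_reduce at hh
  simp only [hmem, FormTripod]
  generalize (γ a).re * Real.cos (θ a) + (γ a).im * Real.sin (θ a) = A at hh ⊢
  generalize (γ b).re * Real.cos (θ b) + (γ b).im * Real.sin (θ b) = B at hh ⊢
  generalize (γ c).re * Real.cos (θ c) + (γ c).im * Real.sin (θ c) = C at hh ⊢
  generalize Real.cos (θ a) = x at *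
  generalize Real.cos (θ b) = y at *
  generalize Real.cos (θ c) = z at *
  generalize Real.sin (θ a) = x' at *
  generalize Real.sin (θ b) = y' at *
  generalize Real.sin (θ c) = z' at *
  have hb' : (e₁ * y) ^ 2 + (e₁ * y') ^ 2 = 1 := by rw [mul_pow, mul_pow, he₁]; linarith
  have hc' : (e₂ * z) ^ 2 + (e₂ * z') ^ 2 = 1 := by rw [mul_pow, mul_pow, he₂]; linarith
  have hab := inner_eq_neg_half_of_add_eq_zero ha hb' hc' hcos hsin
  have hbc := inner_eq_neg_half_of_add_eq_zero hb' hc' ha (by linarith) (by linarith)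
  have hca := inner_eq_neg_half_of_add_eq_zero hc' ha hb' (by linarith) (by linarith)
  -- Signed unit vectors `uᵢ` with sum zero have pairwise inner products `-1/2`. For signed values
  -- `Aᵢ` with sum zero, the point `(2/3) ∑ Aᵢ uᵢ` therefore has inner product `Aⱼ` with each `uⱼ`.
  refine ⟨⟨⟨2 / 3 * (A * x + e₁ * B * (e₁ * y) + e₂ * C * (e₂ * z)),
    2 / 3 * (A * x' + e₁ * B * (e₁ * y') + e₂ * C * (e₂ * z'))⟩, ?_, ?_, ?_⟩,
    _, hda, _, hdb, _, hdc, ?_⟩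
  · linear_combination (2 / 3 * A) * ha + (2 / 3 * e₁ * B) * hab + (2 / 3 * e₂ * C) * hca - hh / 3
  · refine mul_left_cancel₀ (show e₁ ≠ 0 by rintro rfl; norm_num at he₁) ?_
    linear_combination (2 / 3 * A) * hab + (2 / 3 * e₁ * B) * hb' + (2 / 3 * e₂ * C) * hbc - hh / 3
  · refine mul_left_cancel₀ (show e₂ ≠ 0 by rintro rfl; norm_num at he₂) ?_
    linear_combination (2 / 3 * A) * hca + (2 / 3 * e₁ * B) * hbc + (2 / 3 * e₂ * C) * hc' - hh / 3
  · refine ⟨angle_eq_two_pi_div_three ?_ ?_ ?_, angle_eq_two_pi_div_three ?_ ?_ ?_,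
      angle_eq_two_pi_div_three ?_ ?_ ?_⟩ <;> dsimp only <;> linarith

/-- Negating all angles only reverses the sign of the sine equation, so nonpositive curvature
reduces to the nonnegative case. -/
theorem signedBalanced_of_mul {σ : ℝ} (hσ : σ ^ 2 = 1) {h : ℝ → ℝ} {a b c : ℝ}
    (habc : SignedBalanced (fun t => σ * θ t) h a b c) : SignedBalanced θ h a b c := by
  obtain rfl | rfl := sq_eq_one_iff.1 hσ
  · simpa using habc
  · obtain ⟨e₁, e₂, he₁, he₂, hcos, hsin, hh⟩ := habc
    simp only [neg_mul, one_mul, Real.cos_neg, Real.sin_neg] at hcos hsin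
    exact ⟨e₁, e₂, he₁, he₂, hcos, by linarith, hh⟩

theorem hasDerivAt_re (hγ : IsClosedC2 γ T)
    (hθ : ∀ t, deriv γ t = (‖deriv γ t‖ : ℂ) * Complex.exp ((θ t : ℂ) * Complex.I)) (t : ℝ) :
    HasDerivAt (fun t => (γ t).re) (‖deriv γ t‖ * Real.cos (θ t)) t := by
  have hd : HasDerivAt γ (deriv γ t) t := (hγ.contDiff.differentiable (by simp) t).hasDerivAt
  refine (Complex.reCLM.hasFDerivAt.comp_hasDerivAt t hd).congr_deriv ?_
  rw [Complex.reCLM_apply, hθ t, Complex.re_ofReal_mul, Complex.exp_ofReal_mul_I_re, ← hθ t]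

theorem hasDerivAt_im (hγ : IsClosedC2 γ T)
    (hθ : ∀ t, deriv γ t = (‖deriv γ t‖ : ℂ) * Complex.exp ((θ t : ℂ) * Complex.I)) (t : ℝ) :
    HasDerivAt (fun t => (γ t).im) (‖deriv γ t‖ * Real.sin (θ t)) t := by
  have hd : HasDerivAt γ (deriv γ t) t := (hγ.contDiff.differentiable (by simp) t).hasDerivAt
  refine (Complex.imCLM.hasFDerivAt.comp_hasDerivAt t hd).congr_deriv ?_
  rw [Complex.imCLM_apply, hθ t, Complex.im_ofReal_mul, Complex.exp_ofReal_mul_I_im, ← hθ t]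

/-- The tangent angle of a closed regular curve is not constant. -/
theorem exists_angle_ne (hγ : IsClosedC2 γ T)
    (hθ : ∀ t, deriv γ t = (‖deriv γ t‖ : ℂ) * Complex.exp ((θ t : ℂ) * Complex.I)) :
    ∃ t, θ t ≠ θ 0 := by
  by_contra! hconst
  have hd : ∀ t, HasDerivAt (fun t => (γ t).re * Real.cos (θ 0) + (γ t).im * Real.sin (θ 0))
      ‖deriv γ t‖ t := fun t => by
    refine (((hasDerivAt_re hγ hθ t).mul_const (Real.cos (θ 0))).add
      ((hasDerivAt_im hγ hθ t).mul_const (Real.sin (θ 0)))).congr_deriv ?_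
    rw [hconst t]
    linear_combination ‖deriv γ t‖ * Real.cos_sq_add_sin_sq (θ 0)
  have hlt := strictMono_of_deriv_pos (fun t => by
    rw [(hd t).deriv]; exact norm_pos_iff.2 (hγ.regular t)) hγ.period_pos
  have h0 := hγ.periodic 0
  rw [zero_add] at h0
  simp [h0] at hlt

theorem exists_finset_subset_tripodConfigurations (hγ : IsClosedC2 γ T) {n : ℤ}
    (hθc : Continuous θ)
    (hθ : ∀ t, deriv γ t = (‖deriv γ t‖ : ℂ) * Complex.exp ((θ t : ℂ) * Complex.I))
    (hn : θ T - θ 0 = 2 * Real.pi * n) {σ : ℝ} (hσ : σ ^ 2 = 1)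
    (hconv : ∀ t, 0 ≤ σ * curvature γ t) :
    0 < n.natAbs ∧ ∃ F : Finset (Finset ℝ), 8 * n.natAbs ^ 2 ≤ 3 * F.card ∧
      (F : Set (Finset ℝ)) ⊆ tripodConfigurations γ T := by
  have hdθ : ∀ t, HasDerivAt (fun t => σ * θ t) (σ * (curvature γ t * ‖deriv γ t‖)) t :=
    fun t => (hasDerivAt_angle hγ hθc hθ t).const_mul σ
  have hnonneg : ∀ t, 0 ≤ σ * (curvature γ t * ‖deriv γ t‖) := fun t => by
    rw [← mul_assoc]; exact mul_nonneg (hconv t) (norm_nonneg _)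
  have hmono := monotone_of_hasDerivAt_nonneg hdθ hnonneg
  have hadd := angle_add_period hγ hθc hθ
  have hσn : σ * n = n.natAbs := by
    have h0 : 0 ≤ σ * n := by
      have := hmono hγ.period_pos.le
      have h1 : 2 * Real.pi * (σ * n) = σ * θ T - σ * θ 0 := by linear_combination -σ * hn
      have h2 : 0 ≤ 2 * Real.pi * (σ * n) := by rw [h1]; linarith
      exact nonneg_of_mul_nonneg_right h2 (by positivity)
    have h1 : |σ| = 1 := by rwa [← sq_eq_sq₀ (abs_nonneg _) zero_le_one, sq_abs, one_pow]
    rw [← abs_of_nonneg h0, abs_mul, h1, one_mul, Nat.cast_natAbs, Int.cast_abs]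
  -- With `n = 0` the angle is monotone and periodic, hence constant, which a closed regular curve
  -- excludes.
  have hpos : 0 < n.natAbs := by
    refine Nat.pos_of_ne_zero fun h0 => ?_
    obtain ⟨t, ht⟩ := exists_angle_ne hγ hθ
    have hn0 : n = 0 := Int.natAbs_eq_zero.1 h0
    have hper : Function.Periodic (fun t => σ * θ t) T := fun t => by
      simp only [hadd t, hn, hn0, Int.cast_zero, mul_zero, add_zero]
    have hle : ∀ x y, σ * θ x ≤ σ * θ y := fun x y => by
      obtain ⟨z, hz, hyz⟩ := hper.exists_mem_Ico hγ.period_pos y x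
      rw [hyz]
      exact hmono hz.1
    have hσ0 : σ ≠ 0 := by rintro rfl; norm_num at hσ
    exact ht (mul_left_cancel₀ hσ0 (le_antisymm (hle t 0) (hle 0 t)))
  -- This is the support function up to sign. The terms from `γ'` cancel because `γ'` is tangential.
  have hdp : ∀ t, HasDerivAt
      (fun t => σ * ((γ t).re * Real.sin (θ t) - (γ t).im * Real.cos (θ t)))
      (((γ t).re * Real.cos (θ t) + (γ t).im * Real.sin (θ t)) *
        (σ * (curvature γ t * ‖deriv γ t‖))) t := fun t => by
    have h1 := hasDerivAt_angle hγ hθc hθ t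
    refine ((((hasDerivAt_re hγ hθ t).mul h1.sin).sub
      ((hasDerivAt_im hγ hθ t).mul h1.cos)).const_mul σ).congr_deriv ?_
    ring
  have hγc : Continuous γ := hγ.contDiff.continuous
  have htrig : ∀ t, Real.cos (θ (t + T)) = Real.cos (θ t) ∧ Real.sin (θ (t + T)) = Real.sin (θ t) :=
    fun t => by
      rw [hadd t, hn, mul_comm (2 * Real.pi)]
      exact ⟨Real.cos_add_int_mul_two_pi _ _, Real.sin_add_int_mul_two_pi _ _⟩
  refine ⟨hpos, ?_⟩
  obtain ⟨F, hF, hFs⟩ := exists_finset_signedBalanced (T := T) (n := n.natAbs) hdθ hnonneg hdp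
    (by fun_prop) hγ.period_pos hpos
    (fun t => by rw [hadd t, hn, ← hσn]; ring)
    (fun t => by simp only [hγ.periodic t, htrig t])
    (fun t => by simp only [hγ.periodic t, htrig t])
  refine ⟨F, hF, fun s hs => ?_⟩
  obtain ⟨a, b, c, rfl, hsub, hbal⟩ := hFs s hs
  exact ⟨a, b, c, rfl, hsub, formTripod_of_signedBalanced hγ hθ (signedBalanced_of_mul hσ hbal)⟩

end PlaneCurve

theorem theorem3p1 (γ : ℝ → ℂ) (T : ℝ) (n : ℤ)
    (hγ : PlaneCurve.IsClosedC2 γ T)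
    (hconv : PlaneCurve.LocallyConvex γ)
    (hn : PlaneCurve.HasRotationIndex γ T n) :
    ((2 * ⌈((n : ℝ) ^ 2 + 2) / 3⌉₊ : ℕ) : ℕ∞) ≤
      (PlaneCurve.tripodConfigurations γ T).encard := by
  obtain ⟨θ, hθc, hθ, hθn⟩ := hn
  obtain ⟨σ, hσ, hκ⟩ : ∃ σ : ℝ, σ ^ 2 = 1 ∧ ∀ t, 0 ≤ σ * PlaneCurve.curvature γ t := by
    rcases hconv with h | h
    · exact ⟨1, by norm_num, by simpa using h⟩
    · exact ⟨-1, by norm_num, by simpa using h⟩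
  obtain ⟨hpos, F, hF, hsub⟩ :=
    PlaneCurve.exists_finset_subset_tripodConfigurations hγ hθc hθ hθn hσ hκ
  refine le_trans ?_ (Set.encard_le_encard hsub)
  rw [Set.encard_coe_eq_coe_finsetCard, Nat.cast_le]
  have hceil : ⌈((n : ℝ) ^ 2 + 2) / 3⌉₊ ≤ (n.natAbs ^ 2 + 4) / 3 := by
    rw [Nat.ceil_le, div_le_iff₀ (by norm_num)]
    have h1 : n.natAbs ^ 2 + 2 ≤ (n.natAbs ^ 2 + 4) / 3 * 3 := by omega
    have h2 : ((n.natAbs : ℕ) : ℝ) ^ 2 = (n : ℝ) ^ 2 := by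
      rw [Nat.cast_natAbs, Int.cast_abs, sq_abs]
    rw [← h2]
    exact_mod_cast h1
  -- Positivity is essential: for `n = 0` the claimed bound is 2, while `8n²/3` is 0.
  have hsq : 0 < n.natAbs ^ 2 := by positivity
  omega
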